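/- Let $\varphi=\frac{1+\sqrt5}{2}$, $\psi=\frac{1-\sqrt5}{2}=-\frac1\varphi$, and for $n\ge 0$ let $R(n)$ be the number of ways to write $n$ as a sum of distinct Fibonacci numbers from $\{1,2,3,5,8,\dots\}$ (so $R(0)=1$). Let $T$ be the rotation of $\left[-\frac1{\varphi^2},\frac1\varphi\right)$ given by $T(y)=y+\frac1{\varphi^2}$ for $y<\frac1{\varphi^3}$ and $T(y)=y+\frac1{\varphi^2}-1$ for $y\ge\frac1{\varphi^3}$. Let $D=\left(-\frac1{\varphi^2},\frac1{\varphi^3}\right)\cup\left(\frac1{\varphi^3},\frac1\varphi\right)$. There is exactly one continuous function $h:D\to\mathbb R$ with $$h(y)=\begin{cases}1+h(-\varphi y)& y\in\left(-\frac1{\varphi^2},-\frac1{\varphi^4}\right)\\ 1& y\in\left[-\frac1{\varphi^4},0\right]\\ \dfrac{h(-\varphi y+\frac1\varphi)}{1+h(-\varphi y+\frac1\varphi)}& y\in\left(0,\frac1{\varphi^3}\right)\\ h(-\varphi y+\frac1\varphi)& y\in\left(\frac1{\varphi^3},\frac1\varphi\right),\end{cases}$$ and it is the pointwise limit on $D$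 of the iteration of this equation started from the constant function $1$. Call $S\subset\mathbb R$ a cut and project set if there are a lattice $L\subset\mathbb R^2$, linear maps $\pi_1,\pi_2:\mathbb R^2\to\mathbb R$ for which $(\pi_1,\pi_2)$ is bijective, $\pi_2$ is injective on $L$ and $\pi_2(L)$ is dense in $\mathbb R$, and a bounded set $W\subset\mathbb R$ that is a finite union of (possibly degenerate or empty) intervals, such that $\pi_1$ is injective on $\{z\in L:\pi_2(z)\in W\}$ and $S=\pi_1(\{z\in L:\pi_2(z)\in W\})$. Let $P=(p_1,\dots,p_k)$ be any vector of rational numbers. $R$ contains the patch $P$ at time $n$ if $R(n+i)=p_iR(n)$ for $1\le i\le k$. Put $p_0=1$ and $$W_P=\left\{y\in\left(-\tfrac1{\varphi^2},\tfrac1\varphi\right): T^{i-1}(y)\in D\text{ and } p_{i-1}\,h(T^{i-1}(y))=p_i\text{ for }1\le i\le k\right\}.$$ Then $W_P$ is a finite union of (possibly degenerate or empty) intervals, the set $$C_P=\left\{\frac{x-y}{\sqrt5}: x=a+b\varphi,\ y=a+b\psi,\ a,b\in\mathbb Z,\ y\in W_P\right\}$$ is a cut and project set, and $$\{n\ge 0: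 R\text{ contains the patch }P\text{ at time }n\}=C_P\cap[0,\infty).$$ -/

import Mathlib

open Set Filter Topology
open scoped goldenRatio

namespace FibPartition

noncomputable section

/-- The Fibonacci partition function: `R n` is the number of finite sets of (pairwise distinct)
Fibonacci numbers `1, 2, 3, 5, 8, …` with sum `n`. -/
def R (n : ℕ) : ℕ :=
  {s : Finset ℕ | (∀ x ∈ s, ∃ i, 2 ≤ i ∧ Nat.fib i = x) ∧ ∑ x ∈ s, x = n}.ncard

/-- `R` contains the patch `(p₁, …, p_k)` at time `n`: `R (n + i) = p_i * R n` for `1 ≤ i ≤ k`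
(the entry `p_i` is `p (i - 1)` in the indexing by `Fin k`). -/
def ContainsPatch {k : ℕ} (p : Fin k → ℚ) (n : ℕ) : Prop :=
  ∀ i : Fin k, (R (n + (i + 1)) : ℚ) = p i * (R n : ℚ)

/-- The rotation by `1 / φ ^ 2` on the interval `[-1 / φ ^ 2, 1 / φ)` of length one
(only its values on that interval matter). -/
def T (y : ℝ) : ℝ :=
  if y < 1 / φ ^ 3 then y + 1 / φ ^ 2 else y + 1 / φ ^ 2 - 1

/-- The domain of the staircase function. -/
def D : Set ℝ := Ioo (-1 / φ ^ 2) (1 / φ ^ 3) ∪ Ioo (1 / φ ^ 3) (1 / φ)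

/-- `f` is continuous on `D` and satisfies the functional equation that characterizes the
staircase function. All arguments of `f` that occur lie in `D`. -/
structure IsStaircase (f : ℝ → ℝ) : Prop where
  continuousOn : ContinuousOn f D
  eq_left : ∀ y ∈ Ioo (-1 / φ ^ 2) (-1 / φ ^ 4), f y = 1 + f (-φ * y)
  eq_one : ∀ y ∈ Icc (-1 / φ ^ 4) 0, f y = 1
  eq_mid : ∀ y ∈ Ioo 0 (1 / φ ^ 3), f y = f (-φ * y + 1 / φ) / (1 + f (-φ * y + 1 / φ))
  eq_right : ∀ y ∈ Ioo (1 / φ ^ 3) (1 / φ), f y = f (-φ * y + 1 / φ)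

/-- One substitution of `f` into the right-hand side of the functional equation. -/
def stairStep (f : ℝ → ℝ) (y : ℝ) : ℝ :=
  if y < -1 / φ ^ 4 then 1 + f (-φ * y)
  else if y ≤ 0 then 1
  else if y < 1 / φ ^ 3 then f (-φ * y + 1 / φ) / (1 + f (-φ * y + 1 / φ))
  else f (-φ * y + 1 / φ)

/-- The staircase function, as the pointwise limit of the iterates of the functional equation
that start from the constant function `1` (only its values on `D` matter). -/
def h (y : ℝ) : ℝ :=
  limUnder atTop (fun j : ℕ => (stairStep^[j] (fun _ => 1)) y)

/-- The window of the patch `p`: the points `y` of `(-1 / φ ^ 2, 1 / φ)` for which, with `p₀ = 1`,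
the value `h (T ^ i y)` is defined and equal to `p_{i+1} / p_i` for `0 ≤ i < k`. The equation is
written without the division; no `y` satisfies all of them when some `p_i` is zero. -/
def window {k : ℕ} (p : Fin k → ℚ) : Set ℝ :=
  {y | y ∈ Ioo (-1 / φ ^ 2) (1 / φ) ∧
    ∀ i : Fin k, T^[i] y ∈ D ∧
      h (T^[i] y) * (((Fin.cons 1 p : Fin (k + 1) → ℚ) i.castSucc : ℚ) : ℝ)
        = (((Fin.cons 1 p : Fin (k + 1) → ℚ) i.succ : ℚ) : ℝ)}

/-- `W` is a finite union of intervals (open, closed, half-open, degenerate or empty). -/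
def IsFiniteUnionOfIntervals (W : Set ℝ) : Prop :=
  ∃ A : Set (Set ℝ), A.Finite ∧ (∀ I ∈ A, I.OrdConnected) ∧ W = ⋃₀ A

/-- `S` is a cut and project set in the line, with a one-dimensional internal space: there are a
lattice `L` in the plane, complementary linear projections `π₁` (physical) and `π₂` (internal),
where `π₂` is injective on `L` with dense image, and a bounded window `W`, a finite union of
intervals, such that `S` is the image under `π₁` of the lattice points `z` with `π₂ z ∈ W`, and
distinct such lattice points have distinct images. -/
def IsCutAndProjectSet (S : Set ℝ) : Prop :=
  ∃ (L : Submodule ℤ (ℝ × ℝ)) (π₁ π₂ : ℝ × ℝ →ₗ[ℝ] ℝ) (W : Set ℝ),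
    DiscreteTopology L ∧ Submodule.span ℝ (L : Set (ℝ × ℝ)) = ⊤ ∧
    Function.Bijective (fun z => (π₁ z, π₂ z)) ∧
    InjOn π₂ (L : Set (ℝ × ℝ)) ∧ Dense (π₂ '' (L : Set (ℝ × ℝ))) ∧
    Bornology.IsBounded W ∧ IsFiniteUnionOfIntervals W ∧
    InjOn π₁ {z | z ∈ L ∧ π₂ z ∈ W} ∧
    S = π₁ '' {z | z ∈ L ∧ π₂ z ∈ W}

/-- The set of all `(x - y) / √5` where `x = a + b φ`, `y = a + b ψ` with integers `a`, `b`,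
and `y ∈ W`. -/
def goldenCutAndProject (W : Set ℝ) : Set ℝ :=
  {t | ∃ a b : ℤ, ∃ x y : ℝ, x = a + b * φ ∧ y = a + b * ψ ∧ y ∈ W ∧ t = (x - y) / √5}

end

end FibPartition

namespace FibPartition

/-! ### Polynomial form of the constants -/

/-! Attach to `n` the unique point `y = a + n ψ` of `(φ - 2, φ - 1)` with `a` an integer; the
rotation `T` adds `ψ` modulo 1, so `T y` belongs to `n + 1`. Since `ψ ^ (i + 2) = fib (i + 1) + fib
(i + 2) ψ`, and all finite sums of distinct powers `ψ ^ i`, `2 ≤ i`, lie in this interval of length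
one, `R n` is the number of ways to write `y` as such a sum (`coe_R_eq_psiCount`).

Splitting these sums by whether `ψ ^ 2` occurs and dividing by `ψ` gives the recursion
`psiCount_eq_add`. Applied to `y` and `T y` together, it says that `R (n + 1) / R n` obeys the
functional equation at `y`, with a smaller index on the right. The descent ends on the middle
plateau, so the iteration is eventually constant at `y` and `h y = R (n + 1) / R n`
(`R_pos_and_stabilizes`). A patch is therefore a condition on `h` along the orbit of `y` under `T`.

The existence of `h` rests on three facts: the iterates are monotone on either side of the puncture
`2 φ - 3`, the points where the iteration becomes constant are dense, and the constants reached
include all positive rationals. They give convergence, continuity and uniqueness. Monotonicity also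
makes level sets of `h` intervals on each side, and `T` is a piecewise translation, so windows are
finite unions of intervals. -/

theorem phi_mul_self : φ * φ = φ + 1 := by
  rw [← sq]; exact Real.goldenRatio_sq

theorem phi_gt : 8 / 5 < φ := by
  nlinarith [phi_mul_self, Real.goldenRatio_pos]

theorem phi_lt : φ < 13 / 8 := by
  nlinarith [phi_mul_self, Real.goldenRatio_pos]

theorem psi_eq : ψ = 1 - φ := Real.one_sub_goldenConj.symm

theorem one_div_phi : 1 / φ = φ - 1 := by
  rw [div_eq_iff Real.goldenRatio_ne_zero]; linarith [phi_mul_self]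

theorem one_div_phi_sq : 1 / φ ^ 2 = 2 - φ := by
  rw [← one_div_pow, one_div_phi]; linarith [phi_mul_self]

theorem one_div_phi_cube : 1 / φ ^ 3 = 2 * φ - 3 := by
  rw [← one_div_pow, one_div_phi]; linear_combination (φ - 2) * phi_mul_self

theorem neg_one_div_phi_sq : -1 / φ ^ 2 = φ - 2 := by
  rw [neg_div, one_div_phi_sq]; ring

theorem neg_one_div_phi_pow_four : -1 / φ ^ 4 = 3 * φ - 5 := by
  rw [neg_div, ← one_div_pow, one_div_phi]
  linear_combination (-φ ^ 2 + 3 * φ - 4) * phi_mul_self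

/-- The part of the domain to the left of the puncture. -/
def leftPart : Set ℝ := Ioo (φ - 2) (2 * φ - 3)

/-- The part of the domain to the right of the puncture. -/
def rightPart : Set ℝ := Ioo (2 * φ - 3) (φ - 1)

theorem D_eq : D = leftPart ∪ rightPart := by
  rw [D, neg_one_div_phi_sq, one_div_phi_cube, one_div_phi, leftPart, rightPart]

theorem leftPart_subset_D : leftPart ⊆ D := D_eq ▸ subset_union_left

theorem rightPart_subset_D : rightPart ⊆ D := D_eq ▸ subset_union_right

theorem isOpen_D : IsOpen D := isOpen_Ioo.union isOpen_Ioo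

theorem T_eq (y : ℝ) : T y = if y < 2 * φ - 3 then y + (2 - φ) else y + (1 - φ) := by
  rw [T, one_div_phi_cube, one_div_phi_sq]; congr 1; ring

/-! ### The branches of the functional equation -/

section Branches

variable {f : ℝ → ℝ} {y z : ℝ}

theorem stairStep_left (h : y < 3 * φ - 5) : stairStep f y = 1 + f (-φ * y) := by
  rw [stairStep, neg_one_div_phi_pow_four, if_pos h]

theorem stairStep_center (h₁ : 3 * φ - 5 ≤ y) (h₂ : y ≤ 0) : stairStep f y = 1 := by
  rw [stairStep, neg_one_div_phi_pow_four, if_neg h₁.not_gt, if_pos h₂]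

theorem stairStep_mid (h₁ : 0 < y) (h₂ : y < 2 * φ - 3) :
    stairStep f y = f (-φ * y + (φ - 1)) / (1 + f (-φ * y + (φ - 1))) := by
  rw [stairStep, neg_one_div_phi_pow_four, one_div_phi_cube, one_div_phi,
    if_neg (by linarith [phi_lt]), if_neg h₁.not_ge, if_pos h₂]

theorem stairStep_right (h : 2 * φ - 3 ≤ y) : stairStep f y = f (-φ * y + (φ - 1)) := by
  rw [stairStep, neg_one_div_phi_pow_four, one_div_phi_cube, one_div_phi,
    if_neg (by linarith [phi_lt]), if_neg (by linarith [phi_gt]), if_neg h.not_gt]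

theorem neg_phi_mul_anti (h : y ≤ z) : -φ * z ≤ -φ * y := by
  nlinarith [Real.goldenRatio_pos]

theorem neg_phi_mul_strictAnti (h : y < z) : -φ * z < -φ * y := by
  nlinarith [Real.goldenRatio_pos]

theorem left_mapsTo (h₁ : φ - 2 < y) (h₂ : y < 3 * φ - 5) : -φ * y ∈ rightPart := by
  have h₁ := neg_phi_mul_strictAnti h₁
  have h₂ := neg_phi_mul_strictAnti h₂
  constructor <;> nlinarith [phi_mul_self]

theorem mid_mapsTo (h₁ : 0 < y) (h₂ : y < 2 * φ - 3) : -φ * y + (φ - 1) ∈ rightPart := by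
  have h₁ := neg_phi_mul_strictAnti h₁
  have h₂ := neg_phi_mul_strictAnti h₂
  constructor <;> nlinarith [phi_mul_self]

theorem right_mapsTo (h : y ∈ rightPart) : -φ * y + (φ - 1) ∈ leftPart := by
  have h₁ := neg_phi_mul_strictAnti h.1
  have h₂ := neg_phi_mul_strictAnti h.2
  constructor <;> nlinarith [phi_mul_self]

end Branches

/-! ### Points where the iteration becomes constant -/

/-- The iteration of the functional equation reaches the value `r` at `y` after finitely many
steps, whatever function it starts from. -/
def Stabilizes (y r : ℝ) : Prop := ∃ j, ∀ g : ℝ → ℝ, stairStep^[j] g y = r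

namespace Stabilizes

variable {y r : ℝ}

theorem left (h : y < 3 * φ - 5) (hr : Stabilizes (-φ * y) r) : Stabilizes y (1 + r) := by
  obtain ⟨j, hj⟩ := hr
  exact ⟨j + 1, fun g => by rw [Function.iterate_succ_apply', stairStep_left h, hj]⟩

theorem center (h₁ : 3 * φ - 5 ≤ y) (h₂ : y ≤ 0) : Stabilizes y 1 :=
  ⟨1, fun _ => stairStep_center h₁ h₂⟩

theorem mid (h₁ : 0 < y) (h₂ : y < 2 * φ - 3) (hr : Stabilizes (-φ * y + (φ - 1)) r) :
    Stabilizes y (r / (1 + r)) := by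
  obtain ⟨j, hj⟩ := hr
  exact ⟨j + 1, fun g => by rw [Function.iterate_succ_apply', stairStep_mid h₁ h₂, hj]⟩

theorem right (h : 2 * φ - 3 ≤ y) (hr : Stabilizes (-φ * y + (φ - 1)) r) : Stabilizes y r := by
  obtain ⟨j, hj⟩ := hr
  exact ⟨j + 1, fun g => by rw [Function.iterate_succ_apply', stairStep_right h, hj]⟩

theorem eventually_eq (hr : Stabilizes y r) (g : ℝ → ℝ) :
    ∀ᶠ j in atTop, stairStep^[j] g y = r := by
  obtain ⟨j, hj⟩ := hr
  filter_upwards [eventually_ge_atTop j] with m hm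
  obtain ⟨d, rfl⟩ := Nat.exists_eq_add_of_le hm
  rw [Function.iterate_add_apply, hj]

theorem h_eq (hr : Stabilizes y r) : h y = r :=
  (tendsto_const_nhds.congr' ((hr.eventually_eq _).mono fun _ hj => hj.symm)).limUnder_eq

end Stabilizes

/-- An interval in `D` that meets the interior of the plateau is done. Any other lies in a single
branch, whose affine map keeps it in `D` and stretches it by `φ`. This cannot go on, because no
interval in `D` is longer than 1; that makes the base case vacuous. -/
theorem exists_stabilizes_of_one_lt (m : ℕ) :
    ∀ a b : ℝ, Ioo a b ⊆ D → 1 < (b - a) * φ ^ m → ∃ y ∈ Ioo a b, ∃ r, Stabilizes y r := by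
  have hφ := Real.goldenRatio_pos
  have h₁ := phi_gt
  have h₂ := phi_lt
  have hDI : D ⊆ Ioo (φ - 2) (φ - 1) := by
    rw [D_eq]
    exact union_subset (Ioo_subset_Ioo_right (by linarith)) (Ioo_subset_Ioo_left (by linarith))
  have bounds : ∀ a b : ℝ, a < b → Ioo a b ⊆ D → φ - 2 ≤ a ∧ b ≤ φ - 1 := fun a b hab hD =>
    (Ioo_subset_Ioo_iff hab).1 (hD.trans hDI)
  induction m with
  | zero =>
    intro a b hD hlt
    have := bounds a b (by linarith) hD
    linarith
  | succ m ih =>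
    intro a b hD hlt
    have hab : a < b := by
      by_contra! hba
      have := mul_nonpos_of_nonpos_of_nonneg (sub_nonpos.2 hba) (pow_pos hφ (m + 1)).le
      linarith
    obtain ⟨ha, hb⟩ := bounds a b hab hD
    have hpunct : b ≤ 2 * φ - 3 ∨ 2 * φ - 3 ≤ a := by
      by_contra! hc
      have := hD ⟨hc.2, hc.1⟩
      rw [D_eq] at this
      rcases this with h | h
      · exact lt_irrefl _ h.2
      · exact lt_irrefl _ h.1
    have expand : ∀ c : ℝ, (∀ y ∈ Ioo a b, -φ * y + c ∈ D) →
        ∃ y ∈ Ioo a b, ∃ r, Stabilizes (-φ * y + c) r := by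
      intro c hc
      have inv : ∀ z, -φ * ((c - z) / φ) + c = z := fun z => by field_simp; ring
      have mem : ∀ z ∈ Ioo (-φ * b + c) (-φ * a + c), (c - z) / φ ∈ Ioo a b := by
        intro z hz
        rw [mem_Ioo, lt_div_iff₀ hφ, div_lt_iff₀ hφ]
        constructor <;> linarith [hz.1, hz.2]
      obtain ⟨z, hz, r, hr⟩ := ih (-φ * b + c) (-φ * a + c)
        (fun z hz => inv z ▸ hc _ (mem z hz)) (by rw [pow_succ] at hlt; linarith)
      exact ⟨_, mem z hz, r, (inv z).symm ▸ hr⟩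
    rcases hpunct with hb' | ha'
    · rcases le_or_gt b (3 * φ - 5) with hb₁ | hb₁
      · obtain ⟨y, hy, r, hr⟩ := expand 0 fun y hy => by
          rw [add_zero]
          exact rightPart_subset_D (left_mapsTo (by linarith [hy.1]) (by linarith [hy.2]))
        rw [add_zero] at hr
        exact ⟨y, hy, _, hr.left (by linarith [hy.2])⟩
      · rcases le_or_gt 0 a with ha₁ | ha₁
        · obtain ⟨y, hy, r, hr⟩ := expand (φ - 1) fun y hy =>
            rightPart_subset_D (mid_mapsTo (by linarith [hy.1]) (by linarith [hy.2]))
          exact ⟨y, hy, _, hr.mid (by linarith [hy.1]) (by linarith [hy.2])⟩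
        · obtain ⟨y, hy₁, hy₂⟩ : ∃ y, max a (3 * φ - 5) < y ∧ y < min b 0 :=
            exists_between (max_lt (lt_min hab ha₁) (lt_min hb₁ (by linarith)))
          rw [max_lt_iff] at hy₁
          rw [lt_min_iff] at hy₂
          exact ⟨y, ⟨hy₁.1, hy₂.1⟩, 1, .center hy₁.2.le hy₂.2.le⟩
    · obtain ⟨y, hy, r, hr⟩ := expand (φ - 1) fun y hy =>
        leftPart_subset_D (right_mapsTo ⟨by linarith [hy.1], by linarith [hy.2]⟩)
      exact ⟨y, hy, _, hr.right (by linarith [hy.1])⟩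

/-- The points where the iteration becomes constant are dense in `D`. -/
theorem exists_stabilizes {a b : ℝ} (hab : a < b) (hD : Ioo a b ⊆ D) :
    ∃ y ∈ Ioo a b, ∃ r, Stabilizes y r := by
  obtain ⟨m, hm⟩ := pow_unbounded_of_one_lt (1 / (b - a)) Real.one_lt_goldenRatio
  refine exists_stabilizes_of_one_lt m a b hD ?_
  rwa [div_lt_iff₀ (sub_pos.2 hab), mul_comm] at hm

/-- The subtractive Euclidean algorithm: the left branch followed by the right one realizes `r ↦ 1 +
r`, the middle branch followed by the right one realizes `r ↦ r / (1 + r)`, and these two maps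
generate all positive rationals from 1. -/
theorem exists_stabilizes_nat_div (s : ℕ) :
    ∀ p q : ℕ, p + q ≤ s → 0 < p → 0 < q →
      ∃ y ∈ leftPart, Stabilizes y ((p : ℝ) / q) := by
  have hφ := Real.goldenRatio_pos
  have h₁ := phi_gt
  have h₂ := phi_lt
  have h₃ := phi_mul_self
  -- in each branch the preimage of `y` under two steps
  have preim : ∀ y ∈ leftPart, ∀ r, Stabilizes y r →
      Stabilizes (-φ * ((2 - φ) * (y - (φ - 1)))) r := by
    intro y hy r hr
    have hz : -φ * ((2 - φ) * (y - (φ - 1))) = (1 - φ) * (y - (φ - 1)) := by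
      linear_combination (y - φ + 1) * h₃
    rw [hz]
    refine .right ?_ ?_
    · nlinarith [hy.1, hy.2]
    · have : -φ * ((1 - φ) * (y - (φ - 1))) + (φ - 1) = y := by
        linear_combination (y - φ + 1) * h₃
      rwa [this]
  induction s with
  | zero => intro p q hs hp; omega
  | succ s ih =>
    intro p q hs hp hq
    rcases lt_trichotomy p q with hpq | rfl | hpq
    · obtain ⟨y, hy, hr⟩ := ih p (q - p) (by omega) hp (by omega)
      have hd : (0 : ℝ) < (q : ℝ) - p := sub_pos.2 (by exact_mod_cast hpq)
      have hp' : (0 : ℝ) < p := by exact_mod_cast hp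
      rw [Nat.cast_sub hpq.le] at hr
      have hlo : 0 < (2 - φ) * (y - (φ - 2)) := mul_pos (by linarith) (by linarith [hy.1])
      have hhi : (2 - φ) * (y - (φ - 2)) < 2 * φ - 3 := by nlinarith [hy.2]
      -- The solution `z` of `-φ (-φ z + (φ - 1)) + (φ - 1) = y`, where `2 - φ = 1 / φ ^ 2`.
      refine ⟨(2 - φ) * (y - (φ - 2)), ⟨by linarith, hhi⟩, ?_⟩
      have := preim y hy _ hr
      have e : -φ * ((2 - φ) * (y - (φ - 1))) =
          -φ * ((2 - φ) * (y - (φ - 2))) + (φ - 1) := by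
        linear_combination -h₃
      rw [e] at this
      convert! Stabilizes.mid hlo hhi this using 1
      have : (q : ℝ) ≠ 0 := by linarith
      field_simp
      ring
    · have : (p : ℝ) ≠ 0 := by exact_mod_cast hp.ne'
      refine ⟨0, ⟨by linarith, by linarith⟩, ?_⟩
      rw [div_self this]
      exact .center (by linarith) le_rfl
    · obtain ⟨y, hy, hr⟩ := ih (p - q) q (by omega) (by omega) hq
      rw [Nat.cast_sub hpq.le] at hr
      have hhi : (2 - φ) * (y - (φ - 1)) < 3 * φ - 5 := by nlinarith [hy.2]
      have hlo : φ - 2 < (2 - φ) * (y - (φ - 1)) := by nlinarith [hy.1]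
      refine ⟨(2 - φ) * (y - (φ - 1)), ⟨hlo, by linarith⟩, ?_⟩
      convert! (preim y hy _ hr).left hhi using 1
      have : (q : ℝ) ≠ 0 := by exact_mod_cast hq.ne'
      field_simp
      ring

/-- Between two nonnegative numbers there is a value that the iteration reaches on the left
part. -/
theorem exists_stabilizes_between {u v : ℝ} (hu : 0 ≤ u) (huv : u < v) :
    ∃ y ∈ leftPart, ∃ r, u < r ∧ r < v ∧ Stabilizes y r := by
  obtain ⟨q, hq₁, hq₂⟩ := exists_rat_btwn huv
  have hq : 0 < q := by exact_mod_cast hu.trans_lt hq₁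
  obtain ⟨y, hy, hr⟩ := exists_stabilizes_nat_div _ q.num.toNat q.den le_rfl
    (by have := Rat.num_pos.2 hq; omega) q.den_pos
  refine ⟨y, hy, q, hq₁, hq₂, ?_⟩
  convert! hr using 1
  have : ((q.num.toNat : ℕ) : ℝ) = ((q.num : ℤ) : ℝ) := by
    exact_mod_cast congrArg (Int.cast : ℤ → ℝ) (Int.toNat_of_nonneg (Rat.num_pos.2 hq).le)
  rw [this, Rat.cast_def]

/-! ### Monotonicity of the iterates -/

/-- Positivity on `D` and monotonicity on both parts of `D`. -/
structure IsMonotonePair (f : ℝ → ℝ) : Prop where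
  pos : ∀ y ∈ D, 0 < f y
  anti : AntitoneOn f leftPart
  mono : MonotoneOn f rightPart

theorem mem_D_cases {y : ℝ} (hy : y ∈ D) :
    (φ - 2 < y ∧ y < 3 * φ - 5) ∨ (3 * φ - 5 ≤ y ∧ y ≤ 0) ∨ (0 < y ∧ y < 2 * φ - 3) ∨
      y ∈ rightPart := by
  rw [D_eq] at hy
  rcases hy with ⟨h₁, h₂⟩ | hy
  · rcases lt_or_ge y (3 * φ - 5) with h₃ | h₃
    · exact .inl ⟨h₁, h₃⟩
    · rcases le_or_gt y 0 with h₄ | h₄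
      · exact .inr (.inl ⟨h₃, h₄⟩)
      · exact .inr (.inr (.inl ⟨h₄, h₂⟩))
  · exact .inr (.inr (.inr hy))

theorem div_one_add_le {a b : ℝ} (ha : 0 < a) (hab : a ≤ b) : a / (1 + a) ≤ b / (1 + b) := by
  rw [div_le_div_iff₀ (by linarith) (by linarith)]
  linarith

theorem div_one_add_le_one {a : ℝ} (ha : 0 < a) : a / (1 + a) ≤ 1 :=
  (div_le_one (by linarith)).2 (by linarith)

/-- The affine maps reverse order; those of the outer pieces of the left part land in the right
part, and that of the right part lands in the left part. The three pieces of the left part fit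
together because their values are at least 1, equal to 1 and at most 1. -/
theorem IsMonotonePair.stairStep {f : ℝ → ℝ} (hf : IsMonotonePair f) :
    IsMonotonePair (stairStep f) where
  pos y hy := by
    rcases mem_D_cases hy with ⟨h₁, h₂⟩ | ⟨h₁, h₂⟩ | ⟨h₁, h₂⟩ | h
    · rw [stairStep_left h₂]
      have := hf.pos _ (rightPart_subset_D (left_mapsTo h₁ h₂))
      linarith
    · rw [stairStep_center h₁ h₂]
      exact one_pos
    · rw [stairStep_mid h₁ h₂]
      have := hf.pos _ (rightPart_subset_D (mid_mapsTo h₁ h₂))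
      positivity
    · rw [stairStep_right h.1.le]
      exact hf.pos _ (leftPart_subset_D (right_mapsTo h))
  anti y hy z hz hyz := by
    have pos := fun y hy => hf.pos y (rightPart_subset_D hy)
    rcases lt_or_ge y (3 * φ - 5) with hy₁ | hy₁
    · have ry := left_mapsTo hy.1 hy₁
      have py := pos _ ry
      rw [stairStep_left hy₁]
      rcases lt_or_ge z (3 * φ - 5) with hz₁ | hz₁
      · rw [stairStep_left hz₁]
        linarith [hf.mono (left_mapsTo hz.1 hz₁) ry (neg_phi_mul_anti hyz)]
      · rcases le_or_gt z 0 with hz₂ | hz₂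
        · rw [stairStep_center hz₁ hz₂]
          linarith
        · rw [stairStep_mid hz₂ hz.2]
          linarith [div_one_add_le_one (pos _ (mid_mapsTo hz₂ hz.2))]
    · rcases le_or_gt y 0 with hy₂ | hy₂
      · rw [stairStep_center hy₁ hy₂]
        rcases le_or_gt z 0 with hz₂ | hz₂
        · rw [stairStep_center (hy₁.trans hyz) hz₂]
        · rw [stairStep_mid hz₂ hz.2]
          exact div_one_add_le_one (pos _ (mid_mapsTo hz₂ hz.2))
      · have hz₂ := hy₂.trans_le hyz
        rw [stairStep_mid hy₂ hy.2, stairStep_mid hz₂ hz.2]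
        exact div_one_add_le (pos _ (mid_mapsTo hz₂ hz.2))
          (hf.mono (mid_mapsTo hz₂ hz.2) (mid_mapsTo hy₂ hy.2)
            (by linarith [neg_phi_mul_anti hyz]))
  mono y hy z hz hyz := by
    rw [stairStep_right hy.1.le, stairStep_right hz.1.le]
    exact hf.anti (right_mapsTo hz) (right_mapsTo hy) (by linarith [neg_phi_mul_anti hyz])

theorem isMonotonePair_iterate (j : ℕ) : IsMonotonePair (stairStep^[j] (fun _ => 1)) := by
  induction j with
  | zero => exact ⟨fun _ _ => one_pos, fun _ _ _ _ _ => le_rfl, fun _ _ _ _ _ => le_rfl⟩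
  | succ j ih => rw [Function.iterate_succ_apply']; exact ih.stairStep

theorem Stabilizes.pos {y r : ℝ} (hy : y ∈ D) (hr : Stabilizes y r) : 0 < r := by
  obtain ⟨j, hj⟩ := hr
  rw [← hj fun _ => 1]
  exact (isMonotonePair_iterate j).pos y hy

theorem Stabilizes.anti {y z r s : ℝ} (hy : y ∈ leftPart) (hz : z ∈ leftPart) (hyz : y ≤ z)
    (hr : Stabilizes y r) (hs : Stabilizes z s) : s ≤ r := by
  obtain ⟨j, hj, hj'⟩ := ((hr.eventually_eq fun _ => 1).and (hs.eventually_eq fun _ => 1)).exists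
  rw [← hj, ← hj']
  exact (isMonotonePair_iterate j).anti hy hz hyz

/-! ### Convergence of the iteration -/

theorem exists_stabilizes_lt {y : ℝ} (hy : y ∈ leftPart) :
    ∃ z ∈ leftPart, z ≤ y ∧ ∃ r, Stabilizes z r := by
  obtain ⟨z, hz, r, hr⟩ := exists_stabilizes hy.1
    ((Ioo_subset_Ioo_right hy.2.le).trans leftPart_subset_D)
  exact ⟨z, ⟨hz.1, hz.2.trans hy.2⟩, hz.2.le, r, hr⟩

theorem exists_stabilizes_gt {y : ℝ} (hy : y ∈ leftPart) :
    ∃ z ∈ leftPart, y ≤ z ∧ ∃ r, Stabilizes z r := by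
  obtain ⟨z, hz, r, hr⟩ := exists_stabilizes hy.2
    ((Ioo_subset_Ioo_left hy.1.le).trans leftPart_subset_D)
  exact ⟨z, ⟨hy.1.trans hz.1, hz.2⟩, hz.1.le, r, hr⟩

/-- The iterates at `y` are squeezed between their eventual values at stabilizing points on both
sides. Density of the attained values leaves no gap, so the limit is `sSup B`. -/
theorem tendsto_iterate_left {y : ℝ} (hy : y ∈ leftPart) :
    ∃ l, Tendsto (fun j : ℕ => (stairStep^[j] (fun _ => 1)) y) atTop (𝓝 l) := by
  set A : Set ℝ := {r | ∃ z ∈ leftPart, z ≤ y ∧ Stabilizes z r} with hA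
  set B : Set ℝ := {r | ∃ z ∈ leftPart, y ≤ z ∧ Stabilizes z r} with hB
  have hAne : A.Nonempty := by
    obtain ⟨z, hz, hzy, r, hr⟩ := exists_stabilizes_lt hy
    exact ⟨r, z, hz, hzy, hr⟩
  have hBne : B.Nonempty := by
    obtain ⟨z, hz, hzy, r, hr⟩ := exists_stabilizes_gt hy
    exact ⟨r, z, hz, hzy, hr⟩
  have hBA : ∀ s ∈ B, ∀ r ∈ A, s ≤ r := by
    rintro s ⟨z, hz, hyz, hs⟩ r ⟨w, hw, hwy, hr⟩
    exact hr.anti hw hz (hwy.trans hyz) hs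
  have hBbdd : BddAbove B := ⟨hAne.some, fun s hs => hBA s hs _ hAne.some_mem⟩
  have hB0 : 0 ≤ sSup B := by
    obtain ⟨s, hs⟩ := hBne
    have := le_csSup hBbdd hs
    obtain ⟨z, hz, -, hs⟩ := hs
    exact (hs.pos (leftPart_subset_D hz)).le.trans this
  refine ⟨sSup B, tendsto_order.2 ⟨fun u hu => ?_, fun u hu => ?_⟩⟩
  · obtain ⟨s, ⟨z, hz, hyz, hs⟩, hus⟩ := exists_lt_of_lt_csSup hBne hu
    filter_upwards [hs.eventually_eq fun _ => 1] with j hj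
    rw [← hj] at hus
    exact hus.trans_le ((isMonotonePair_iterate j).anti hy hz hyz)
  -- A value above `sSup B` is not in `B`, so it must be attained to the left of `y`, where it
  -- bounds the iterates at `y` from above.
  · obtain ⟨z, hz, r, hr₁, hr₂, hr⟩ := exists_stabilizes_between hB0 hu
    have hzy : z ≤ y := by
      by_contra! hyz
      exact hr₁.not_ge (le_csSup hBbdd ⟨z, hz, hyz.le, hr⟩)
    filter_upwards [hr.eventually_eq fun _ => 1] with j hj
    rw [← hj] at hr₂
    exact ((isMonotonePair_iterate j).anti hz hy hzy).trans_lt hr₂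

/-- The iteration of the functional equation from the constant function `1` converges to `h`
on `D`. -/
theorem tendsto_iterate {y : ℝ} (hy : y ∈ D) :
    Tendsto (fun j : ℕ => (stairStep^[j] (fun _ => 1)) y) atTop (𝓝 (h y)) := by
  refine tendsto_nhds_limUnder ?_
  rw [D_eq] at hy
  rcases hy with hy | hy
  · exact tendsto_iterate_left hy
  · obtain ⟨l, hl⟩ := tendsto_iterate_left (right_mapsTo hy)
    refine ⟨l, (tendsto_add_atTop_iff_nat 1).1 (hl.congr fun j => ?_)⟩
    rw [Function.iterate_succ_apply', stairStep_right hy.1.le]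

theorem h_antitoneOn : AntitoneOn h leftPart := fun _ hy _ hz hyz =>
  le_of_tendsto_of_tendsto' (tendsto_iterate (leftPart_subset_D hz))
    (tendsto_iterate (leftPart_subset_D hy)) fun j => (isMonotonePair_iterate j).anti hy hz hyz

theorem h_monotoneOn : MonotoneOn h rightPart := fun _ hy _ hz hyz =>
  le_of_tendsto_of_tendsto' (tendsto_iterate (rightPart_subset_D hy))
    (tendsto_iterate (rightPart_subset_D hz)) fun j => (isMonotonePair_iterate j).mono hy hz hyz

theorem h_nonneg {y : ℝ} (hy : y ∈ D) : 0 ≤ h y :=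
  ge_of_tendsto' (tendsto_iterate hy) fun j => ((isMonotonePair_iterate j).pos y hy).le

theorem h_pos_of_mem_leftPart {y : ℝ} (hy : y ∈ leftPart) : 0 < h y := by
  obtain ⟨z, hz, hyz, r, hr⟩ := exists_stabilizes_gt hy
  calc 0 < r := hr.pos (leftPart_subset_D hz)
    _ = h z := hr.h_eq.symm
    _ ≤ h y := h_antitoneOn hy hz hyz

/-! ### The staircase function -/

theorem h_left {y : ℝ} (h₁ : φ - 2 < y) (h₂ : y < 3 * φ - 5) : h y = 1 + h (-φ * y) := by
  have hD : y ∈ D := leftPart_subset_D ⟨h₁, by linarith [phi_gt, phi_lt]⟩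
  refine tendsto_nhds_unique ((tendsto_add_atTop_iff_nat 1).2 (tendsto_iterate hD)) ?_
  refine ((tendsto_iterate (rightPart_subset_D (left_mapsTo h₁ h₂))).const_add 1).congr
    fun j => ?_
  rw [Function.iterate_succ_apply', stairStep_left h₂]

theorem h_mid {y : ℝ} (h₁ : 0 < y) (h₂ : y < 2 * φ - 3) :
    h y = h (-φ * y + (φ - 1)) / (1 + h (-φ * y + (φ - 1))) := by
  have hD : y ∈ D := leftPart_subset_D ⟨by linarith [phi_lt], h₂⟩
  have hD' := rightPart_subset_D (mid_mapsTo h₁ h₂)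
  refine tendsto_nhds_unique ((tendsto_add_atTop_iff_nat 1).2 (tendsto_iterate hD)) ?_
  have hlim := tendsto_iterate hD'
  refine (hlim.div (hlim.const_add 1) (by linarith [h_nonneg hD'])).congr fun j => ?_
  rw [Function.iterate_succ_apply', stairStep_mid h₁ h₂]; rfl

theorem h_right {y : ℝ} (hy : y ∈ rightPart) : h y = h (-φ * y + (φ - 1)) := by
  refine tendsto_nhds_unique
    ((tendsto_add_atTop_iff_nat 1).2 (tendsto_iterate (rightPart_subset_D hy))) ?_
  refine (tendsto_iterate (leftPart_subset_D (right_mapsTo hy))).congr fun j => ?_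
  rw [Function.iterate_succ_apply', stairStep_right hy.1.le]

/-- A monotone function whose values are dense around `h y` has no jump at `y`. -/
theorem h_continuousOn_leftPart : ContinuousOn h leftPart := by
  intro y hy
  have key : ContinuousAt (fun y => -h y) y := by
    refine continuousAt_of_monotoneOn_of_exists_between h_antitoneOn.neg
      (isOpen_Ioo.mem_nhds hy) (fun b hb => ?_) fun b hb => ?_
    · obtain ⟨z, hz, r, h₁, h₂, hr⟩ := exists_stabilizes_between (h_nonneg (leftPart_subset_D hy))
        (lt_neg_of_lt_neg hb)
      exact ⟨z, hz, by rw [hr.h_eq]; exact lt_neg_of_lt_neg h₂,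
        by rw [hr.h_eq]; exact neg_lt_neg h₁⟩
    · obtain ⟨z, hz, r, h₁, h₂, hr⟩ := exists_stabilizes_between (le_max_left 0 (-b))
        (max_lt (h_pos_of_mem_leftPart hy) (neg_lt.1 hb))
      rw [max_lt_iff] at h₁
      exact ⟨z, hz, by rw [hr.h_eq]; exact neg_lt_neg h₂, by rw [hr.h_eq]; exact neg_lt.1 h₁.2⟩
  exact (key.neg.congr (.of_forall fun z => neg_neg (h z))).continuousWithinAt

theorem h_continuousOn : ContinuousOn h D := by
  rw [D_eq]
  refine h_continuousOn_leftPart.union_of_isOpen ?_ isOpen_Ioo isOpen_Ioo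
  exact (h_continuousOn_leftPart.comp (f := fun y => -φ * y + (φ - 1)) (by fun_prop)
    fun y hy => right_mapsTo hy).congr fun y hy => h_right hy

theorem isStaircase_h : IsStaircase h where
  continuousOn := h_continuousOn
  eq_left y hy := by
    rw [neg_one_div_phi_sq, neg_one_div_phi_pow_four] at hy
    exact h_left hy.1 hy.2
  eq_one y hy := by
    rw [neg_one_div_phi_pow_four] at hy
    exact (Stabilizes.center hy.1 hy.2).h_eq
  eq_mid y hy := by
    rw [one_div_phi_cube] at hy
    rw [one_div_phi]
    exact h_mid hy.1 hy.2
  eq_right y hy := by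
    rw [one_div_phi_cube, one_div_phi] at hy
    rw [one_div_phi]
    exact h_right hy

theorem IsStaircase.eq_iterate {g : ℝ → ℝ} (hg : IsStaircase g) (j : ℕ) :
    ∀ y ∈ D, stairStep^[j] g y = g y := by
  induction j with
  | zero => exact fun y _ => rfl
  | succ j ih =>
    intro y hy
    rw [Function.iterate_succ_apply']
    rcases mem_D_cases hy with ⟨h₁, h₂⟩ | ⟨h₁, h₂⟩ | ⟨h₁, h₂⟩ | h
    · rw [stairStep_left h₂, ih _ (rightPart_subset_D (left_mapsTo h₁ h₂)), hg.eq_left y]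
      rw [neg_one_div_phi_sq, neg_one_div_phi_pow_four]
      exact ⟨h₁, h₂⟩
    · rw [stairStep_center h₁ h₂, hg.eq_one y]
      rw [neg_one_div_phi_pow_four]
      exact ⟨h₁, h₂⟩
    · rw [stairStep_mid h₁ h₂, ih _ (rightPart_subset_D (mid_mapsTo h₁ h₂)), hg.eq_mid y,
        one_div_phi]
      rw [one_div_phi_cube]
      exact ⟨h₁, h₂⟩
    · rw [stairStep_right h.1.le, ih _ (leftPart_subset_D (right_mapsTo h)), hg.eq_right y,
        one_div_phi]
      rw [one_div_phi_cube, one_div_phi]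
      exact h

/-- Any solution is fixed by `stairStep` on `D`, and stabilization does not depend on the starting
function, so `g` and `h` agree on a dense set; continuity does the rest. -/
theorem IsStaircase.eqOn_h {g : ℝ → ℝ} (hg : IsStaircase g) : EqOn g h D := by
  intro y hy
  by_contra hne
  have hnhds := isOpen_D.mem_nhds hy
  have hev : ∀ᶠ z in 𝓝 y, z ∈ D ∧ g z ≠ h z :=
    (eventually_mem_nhds_iff.2 hnhds |>.mono fun z hz => mem_of_mem_nhds hz).and
      (((hg.continuousOn.continuousAt hnhds).prodMk_nhds
        (h_continuousOn.continuousAt hnhds)).eventually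
          (isClosed_diagonal.isOpen_compl.mem_nhds hne))
  obtain ⟨a, b, hab, hsub⟩ := mem_nhds_iff_exists_Ioo_subset.1 hev
  obtain ⟨z, hz, r, j, hj⟩ := exists_stabilizes (hab.1.trans hab.2) fun z hz => (hsub hz).1
  refine (hsub hz).2 ?_
  rw [Stabilizes.h_eq ⟨j, hj⟩, ← hg.eq_iterate j z (hsub hz).1, hj]

/-! ### Finite unions of intervals -/

namespace IsFiniteUnionOfIntervals

variable {V W : Set ℝ}

theorem _root_.Set.OrdConnected.isFiniteUnionOfIntervals (hW : W.OrdConnected) :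
    IsFiniteUnionOfIntervals W :=
  ⟨{W}, finite_singleton W, by simpa using hW, by simp⟩

theorem union (hV : IsFiniteUnionOfIntervals V) (hW : IsFiniteUnionOfIntervals W) :
    IsFiniteUnionOfIntervals (V ∪ W) := by
  obtain ⟨A, hA, hA', rfl⟩ := hV
  obtain ⟨B, hB, hB', rfl⟩ := hW
  exact ⟨A ∪ B, hA.union hB, fun I hI => hI.elim (hA' I) (hB' I), sUnion_union A B |>.symm⟩

theorem inter (hV : IsFiniteUnionOfIntervals V) (hW : IsFiniteUnionOfIntervals W) :
    IsFiniteUnionOfIntervals (V ∩ W) := by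
  obtain ⟨A, hA, hA', rfl⟩ := hV
  obtain ⟨B, hB, hB', rfl⟩ := hW
  refine ⟨image2 (· ∩ ·) A B, hA.image2 _ hB, ?_, ?_⟩
  · rintro _ ⟨I, hI, J, hJ, rfl⟩
    exact (hA' I hI).inter (hB' J hJ)
  · ext y
    simp only [mem_inter_iff, mem_sUnion, mem_image2]
    constructor
    · rintro ⟨⟨I, hI, hy⟩, J, hJ, hy'⟩
      exact ⟨_, ⟨I, hI, J, hJ, rfl⟩, hy, hy'⟩
    · rintro ⟨_, ⟨I, hI, J, hJ, rfl⟩, hy, hy'⟩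
      exact ⟨⟨I, hI, hy⟩, J, hJ, hy'⟩

theorem preimage (hW : IsFiniteUnionOfIntervals W) {f : ℝ → ℝ} (hf : Monotone f) :
    IsFiniteUnionOfIntervals (f ⁻¹' W) := by
  obtain ⟨A, hA, hA', rfl⟩ := hW
  refine ⟨(f ⁻¹' ·) '' A, hA.image _, ?_, ?_⟩
  · rintro _ ⟨I, hI, rfl⟩
    exact (hA' I hI).preimage_mono hf
  · rw [preimage_sUnion, sUnion_image]

theorem iInter {ι : Type*} [Finite ι] {W : ι → Set ℝ} (hW : ∀ i, IsFiniteUnionOfIntervals (W i)) :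
    IsFiniteUnionOfIntervals (⋂ i, W i) := by
  have key : ∀ s : Set ι, s.Finite → IsFiniteUnionOfIntervals (⋂ i ∈ s, W i) := by
    intro s hs
    induction s, hs using Set.Finite.induction_on with
    | empty => simpa using ordConnected_univ.isFiniteUnionOfIntervals
    | insert _ _ ih => rw [biInter_insert]; exact (hW _).inter ih
  simpa using key univ finite_univ

theorem preimage_T (hW : IsFiniteUnionOfIntervals W) : IsFiniteUnionOfIntervals (T ⁻¹' W) := by
  have e : T ⁻¹' W = Iio (2 * φ - 3) ∩ (fun y => y + (2 - φ)) ⁻¹' W ∪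
      Ici (2 * φ - 3) ∩ (fun y => y + (1 - φ)) ⁻¹' W := by
    ext y
    rcases lt_or_ge y (2 * φ - 3) with hy | hy
    · simp [T_eq, hy, hy.not_ge]
    · simp [T_eq, hy, hy.not_gt]
  rw [e]
  exact (ordConnected_Iio.isFiniteUnionOfIntervals.inter
    (hW.preimage fun _ _ h => by simpa using h)).union
    (ordConnected_Ici.isFiniteUnionOfIntervals.inter (hW.preimage fun _ _ h => by simpa using h))

theorem preimage_T_iterate (hW : IsFiniteUnionOfIntervals W) (i : ℕ) :
    IsFiniteUnionOfIntervals (T^[i] ⁻¹' W) := by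
  induction i with
  | zero => exact hW
  | succ i ih => rw [Function.iterate_succ, preimage_comp]; exact ih.preimage_T

end IsFiniteUnionOfIntervals

theorem isFiniteUnionOfIntervals_inter_preimage_h {I : Set ℝ} (hI : I.OrdConnected) :
    IsFiniteUnionOfIntervals (D ∩ h ⁻¹' I) := by
  rw [D_eq, union_inter_distrib_right]
  obtain ⟨u, hu, e⟩ := hI.preimage_antitoneOn h_antitoneOn
  obtain ⟨v, hv, e'⟩ := hI.preimage_monotoneOn h_monotoneOn
  rw [e, e']
  exact (ordConnected_Ioo.inter hu).isFiniteUnionOfIntervals.union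
    (ordConnected_Ioo.inter hv).isFiniteUnionOfIntervals

theorem ordConnected_setOf_mul_eq (c d : ℝ) : {t : ℝ | t * c = d}.OrdConnected := by
  rcases eq_or_ne c 0 with rfl | hc
  · simp only [mul_zero]
    by_cases hd : 0 = d <;> simp [hd, ordConnected_univ, ordConnected_empty]
  · have : {t : ℝ | t * c = d} = {d / c} := by
      ext t
      exact (eq_div_iff hc).symm
    rw [this]
    exact ordConnected_singleton

theorem isFiniteUnionOfIntervals_window {k : ℕ} (p : Fin k → ℚ) :
    IsFiniteUnionOfIntervals (window p) := by
  have e : window p = Ioo (-1 / φ ^ 2) (1 / φ) ∩ ⋂ i : Fin k, T^[i] ⁻¹' (D ∩ h ⁻¹' {t : ℝ |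
      t * (((Fin.cons 1 p : Fin (k + 1) → ℚ) i.castSucc : ℚ) : ℝ) =
        (((Fin.cons 1 p : Fin (k + 1) → ℚ) i.succ : ℚ) : ℝ)}) := by
    ext y
    simp only [mem_inter_iff, mem_iInter]
    rfl
  rw [e]
  exact ordConnected_Ioo.isFiniteUnionOfIntervals.inter (.iInter fun i =>
    (isFiniteUnionOfIntervals_inter_preimage_h (ordConnected_setOf_mul_eq _ _)).preimage_T_iterate
      i)

/-! ### The cut and project scheme -/

theorem eq_zero_of_add_mul_psi {a b : ℤ} (h : (a : ℝ) + b * ψ = 0) : a = 0 ∧ b = 0 := by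
  have hb : b = 0 := by
    by_contra hb
    refine (Real.goldenConj_irrational.intCast_mul hb).intCast_add a ⟨0, ?_⟩
    rw [h, Rat.cast_zero]
  subst hb
  simpa using h

theorem add_mul_psi_inj {a b c d : ℤ} (h : (a : ℝ) + b * ψ = c + d * ψ) : a = c ∧ b = d := by
  have := eq_zero_of_add_mul_psi (a := a - c) (b := b - d) (by push_cast; linarith)
  omega

theorem dense_range_add_mul_psi : Dense {t : ℝ | ∃ a b : ℤ, t = a + b * ψ} := by
  have hirr : Irrational (1 / ψ) := by
    rw [one_div, Real.inv_goldenConj]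
    exact Real.goldenRatio_irrational.neg
  convert! dense_addSubgroupClosure_pair_iff.2 hirr using 1
  ext t
  rw [SetLike.mem_coe, AddSubgroup.mem_closure_pair]
  simp only [zsmul_eq_mul, mul_one, eq_comm, mem_ofPred_eq]

/-- The number `(x - y) / √5` is the coefficient `b` of `x = a + b φ`. -/
theorem mem_goldenCutAndProject {W : Set ℝ} {t : ℝ} :
    t ∈ goldenCutAndProject W ↔ ∃ a b : ℤ, (a : ℝ) + b * ψ ∈ W ∧ t = b := by
  have key : ∀ a b : ℤ, ((a : ℝ) + b * φ - (a + b * ψ)) / √5 = b := by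
    intro a b
    rw [div_eq_iff (by positivity), ← Real.goldenRatio_sub_goldenConj]
    ring
  constructor
  · rintro ⟨a, b, x, y, rfl, rfl, hW, rfl⟩
    exact ⟨a, b, hW, key a b⟩
  · rintro ⟨a, b, hW, rfl⟩
    exact ⟨a, b, _, _, rfl, rfl, hW, (key a b).symm⟩

/-- The lattice is `ℤ ^ 2`, with `(a, b)` projected to `b` and to `a + b ψ`. As the window lies in
an open interval of length one, `b` determines `a`. -/
theorem isCutAndProjectSet_goldenCutAndProject {W : Set ℝ} (hW : IsFiniteUnionOfIntervals W)
    (hsub : W ⊆ Ioo (-1 / φ ^ 2) (1 / φ)) : IsCutAndProjectSet (goldenCutAndProject W) := by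
  set L : Submodule ℤ (ℝ × ℝ) := Submodule.span ℤ (range (Module.Basis.finTwoProd ℝ)) with hL
  have mem_L : ∀ z : ℝ × ℝ, z ∈ L ↔ ∃ a b : ℤ, z = ((a : ℝ), (b : ℝ)) := by
    intro z
    have : range (Module.Basis.finTwoProd ℝ) = {((1 : ℝ), (0 : ℝ)), (0, 1)} := by
      ext w
      simp [Fin.exists_fin_two, eq_comm]
    rw [hL, this, Submodule.mem_span_pair]
    simp [eq_comm]
  refine ⟨L, LinearMap.snd ℝ ℝ ℝ, LinearMap.fst ℝ ℝ ℝ + ψ • LinearMap.snd ℝ ℝ ℝ, W,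
    by rw [hL]; infer_instance, ZSpan.span_top _, ⟨?_, ?_⟩, ?_, ?_,
    (Metric.isBounded_Ioo _ _).subset hsub, hW, ?_, ?_⟩
  · rintro ⟨a, b⟩ ⟨c, d⟩ h
    simp only [LinearMap.snd_apply, LinearMap.add_apply, LinearMap.fst_apply,
      LinearMap.smul_apply, smul_eq_mul, Prod.mk.injEq] at h
    obtain ⟨rfl, h⟩ := h
    simpa using h
  · rintro ⟨u, v⟩
    exact ⟨(v - ψ * u, u), by simp⟩
  · intro z hz w hw h
    obtain ⟨a, b, rfl⟩ := (mem_L z).1 hz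
    obtain ⟨c, d, rfl⟩ := (mem_L w).1 hw
    obtain ⟨rfl, rfl⟩ := add_mul_psi_inj (a := a) (b := b) (c := c) (d := d)
      (by simpa [mul_comm] using h)
    rfl
  · refine dense_range_add_mul_psi.mono ?_
    rintro _ ⟨a, b, rfl⟩
    exact ⟨_, (mem_L _).2 ⟨a, b, rfl⟩, by simp [mul_comm]⟩
  · rintro z ⟨hz, hzW⟩ w ⟨hw, hwW⟩ h
    obtain ⟨a, b, rfl⟩ := (mem_L z).1 hz
    obtain ⟨c, d, rfl⟩ := (mem_L w).1 hw
    obtain rfl : b = d := by simpa using h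
    have hz := hsub hzW
    have hw := hsub hwW
    rw [neg_one_div_phi_sq, one_div_phi] at hz hw
    simp only [LinearMap.add_apply, LinearMap.fst_apply, LinearMap.smul_apply,
      LinearMap.snd_apply, smul_eq_mul, mem_Ioo] at hz hw
    have h₁ : (a : ℝ) < c + 1 := by linarith
    have h₂ : (c : ℝ) < a + 1 := by linarith
    norm_cast at h₁ h₂
    obtain rfl : a = c := by omega
    rfl
  · ext t
    rw [mem_goldenCutAndProject]
    constructor
    · rintro ⟨a, b, h, rfl⟩
      exact ⟨(a, b), ⟨(mem_L _).2 ⟨a, b, rfl⟩, by simpa [mul_comm] using h⟩, rfl⟩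
    · rintro ⟨z, ⟨hz, hzW⟩, rfl⟩
      obtain ⟨a, b, rfl⟩ := (mem_L z).1 hz
      exact ⟨a, b, by simpa [mul_comm] using hzW, rfl⟩

/-! ### Counting representations in powers of `ψ` -/

/-- The sum of the powers `ψ ^ (i + 2)` over a finite set of indices. -/
noncomputable def psiSum (t : Finset ℕ) : ℝ := ∑ i ∈ t, ψ ^ (i + 2)

/-- The set of all successors of elements of a finite set. -/
def shift (t : Finset ℕ) : Finset ℕ := t.map ⟨Nat.succ, Nat.succ_injective⟩

/-- The number of representations of `y` as a sum of distinct powers `ψ ^ i` with `2 ≤ i`. -/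
noncomputable def psiCount (y : ℝ) : ℕ∞ := {t : Finset ℕ | psiSum t = y}.encard

theorem zero_notMem_shift (t : Finset ℕ) : 0 ∉ shift t := by simp [shift]

theorem shift_injective : Function.Injective shift := Finset.map_injective _

theorem insert_zero_shift_injective : Function.Injective fun t => insert 0 (shift t) := by
  intro s t h
  have := congrArg (Finset.erase · 0) h
  simp only [Finset.erase_insert (zero_notMem_shift _)] at this
  exact shift_injective this

theorem eq_shift_or_insert (t : Finset ℕ) :
    ∃ s, t = shift s ∨ t = insert 0 (shift s) := by
  refine ⟨t.preimage Nat.succ Nat.succ_injective.injOn, ?_⟩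
  by_cases h : 0 ∈ t
  · right
    ext (_ | i) <;> simp [shift, h]
  · left
    ext (_ | i) <;> simp [shift, h]

theorem psiSum_shift (t : Finset ℕ) : psiSum (shift t) = ψ * psiSum t := by
  rw [psiSum, shift, Finset.sum_map, psiSum, Finset.mul_sum]
  exact Finset.sum_congr rfl fun i _ => by simp [pow_succ]; ring

theorem psiSum_insert_zero_shift (t : Finset ℕ) :
    psiSum (insert 0 (shift t)) = ψ ^ 2 + ψ * psiSum t := by
  rw [← psiSum_shift, psiSum, Finset.sum_insert (zero_notMem_shift t)]
  rfl

/-- The endpoints are the infinite sums of all odd and of all even powers. In the induction, `y ↦ ψ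
y` and `y ↦ ψ ^ 2 + ψ y` map the interval into itself. -/
theorem psiSum_mem_Ioo (t : Finset ℕ) : psiSum t ∈ Ioo (φ - 2) (φ - 1) := by
  have h₁ := phi_gt
  have h₂ := phi_lt
  have h₃ := phi_mul_self
  have key : ∀ m : ℕ, ∀ t : Finset ℕ, (∀ i ∈ t, i < m) →
      φ - 2 < psiSum t ∧ psiSum t < φ - 1 := by
    intro m
    induction m with
    | zero =>
      intro t ht
      obtain rfl : t = ∅ := Finset.eq_empty_of_forall_notMem fun i hi => absurd (ht i hi) (by simp)
      simp only [psiSum, Finset.sum_empty]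
      constructor <;> linarith
    | succ m ih =>
      intro t ht
      obtain ⟨s, hs⟩ := eq_shift_or_insert t
      have hs' : ∀ i ∈ s, i < m := fun i hi => by
        have := ht (i + 1) (by rcases hs with rfl | rfl <;> simp [shift, hi])
        omega
      obtain ⟨lo, hi⟩ := ih s hs'
      rcases hs with rfl | rfl
      · rw [psiSum_shift, psi_eq]
        constructor <;> nlinarith
      · rw [psiSum_insert_zero_shift, psi_eq]
        constructor <;> nlinarith
  exact key (t.sup id + 1) t fun i hi => Nat.lt_succ_of_le (Finset.le_sup (f := id) hi)

theorem psiCount_eq_zero {y : ℝ} (hy : y ∉ Ioo (φ - 2) (φ - 1)) : psiCount y = 0 := by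
  rw [psiCount, encard_eq_zero, eq_empty_iff_forall_notMem]
  rintro t rfl
  exact hy (psiSum_mem_Ioo t)

theorem psiCount_eq_add (y : ℝ) :
    psiCount y = psiCount (-φ * y) + psiCount (-φ * y + (φ - 1)) := by
  have h₃ := phi_mul_self
  have hφ := Real.goldenRatio_pos
  have e : {t | psiSum t = y} = shift '' {t | psiSum t = -φ * y} ∪
      (fun t => insert 0 (shift t)) '' {t | psiSum t = -φ * y + (φ - 1)} := by
    ext t
    constructor
    · rintro rfl
      obtain ⟨s, rfl | rfl⟩ := eq_shift_or_insert t
      · refine .inl ⟨s, ?_, rfl⟩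
        rw [mem_ofPred_eq, psiSum_shift, psi_eq]
        linear_combination (-psiSum s) * h₃
      · refine .inr ⟨s, ?_, rfl⟩
        rw [mem_ofPred_eq, psiSum_insert_zero_shift, psi_eq]
        linear_combination (φ - 1 - psiSum s) * h₃
    · rintro (⟨s, hs, rfl⟩ | ⟨s, hs, rfl⟩)
      · rw [mem_ofPred_eq] at hs ⊢
        rw [psiSum_shift, psi_eq, hs]
        linear_combination y * h₃
      · rw [mem_ofPred_eq] at hs ⊢
        rw [psiSum_insert_zero_shift, psi_eq, hs]
        linear_combination y * h₃
  rw [psiCount, e, encard_union_eq, shift_injective.encard_image,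
    insert_zero_shift_injective.encard_image]
  · rfl
  · rw [disjoint_left]
    rintro _ ⟨s, -, rfl⟩ ⟨t, -, h⟩
    exact zero_notMem_shift s (h ▸ Finset.mem_insert_self 0 (shift t))

theorem psiCount_of_nonpos {y : ℝ} (hy : y ≤ 0) : psiCount y = psiCount (-φ * y) := by
  rw [psiCount_eq_add, psiCount_eq_zero (y := -φ * y + (φ - 1)), add_zero]
  intro h
  nlinarith [h.2, Real.goldenRatio_pos]

theorem psiCount_of_le {y : ℝ} (hy : 2 * φ - 3 ≤ y) :
    psiCount y = psiCount (-φ * y + (φ - 1)) := by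
  rw [psiCount_eq_add, psiCount_eq_zero (y := -φ * y), zero_add]
  intro h
  nlinarith [h.1, Real.goldenRatio_pos, phi_mul_self]

theorem psiSum_eq (t : Finset ℕ) :
    psiSum t = ((∑ i ∈ t, Nat.fib (i + 1) : ℕ) : ℤ) + ((∑ i ∈ t, Nat.fib (i + 2) : ℕ) : ℤ) * ψ := by
  push_cast
  rw [psiSum, Finset.sum_mul, ← Finset.sum_add_distrib]
  refine Finset.sum_congr rfl fun i _ => ?_
  rw [← Real.goldenConj_mul_fib_succ_add_fib]
  ring

theorem finite_setOf_sum_fib_eq (n : ℕ) :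
    {t : Finset ℕ | ∑ i ∈ t, Nat.fib (i + 2) = n}.Finite := by
  refine (Finset.finite_toSet (Finset.range (n + 1)).powerset).subset fun t ht => ?_
  rw [Finset.mem_coe, Finset.mem_powerset]
  intro i hi
  have h₁ : Nat.fib (i + 2) ≤ n := by
    rw [← show _ = n from ht]
    exact Finset.single_le_sum (f := fun i => Nat.fib (i + 2)) (fun _ _ => Nat.zero_le _) hi
  have h₂ : i ≤ Nat.fib (i + 2) := Nat.fib_add_two_strictMono.le_apply
  exact Finset.mem_range.2 (by omega)

theorem R_eq_ncard (n : ℕ) : R n = {t : Finset ℕ | ∑ i ∈ t, Nat.fib (i + 2) = n}.ncard := by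
  let e : ℕ ↪ ℕ := ⟨fun i => Nat.fib (i + 2), Nat.fib_add_two_strictMono.injective⟩
  rw [R, ← ncard_image_of_injective {t : Finset ℕ | ∑ i ∈ t, Nat.fib (i + 2) = n} (Finset.map_injective e)]
  congr 1
  ext s
  constructor
  · rintro ⟨hs, hsum⟩
    have : (s : Set ℕ) ⊆ e '' univ := fun x hx => by
      obtain ⟨i, hi, rfl⟩ := hs x hx
      exact ⟨i - 2, mem_univ _, by simp [e, Nat.sub_add_cancel hi]⟩
    obtain ⟨t, -, rfl⟩ := Finset.subset_set_image_iff.1 this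
    rw [← Finset.map_eq_image] at hsum ⊢
    exact ⟨t, by simpa [Finset.sum_map, e] using hsum, rfl⟩
  · rintro ⟨t, ht, rfl⟩
    refine ⟨fun x hx => ?_, by simpa [Finset.sum_map, e] using ht⟩
    obtain ⟨i, -, rfl⟩ := Finset.mem_map.1 hx
    exact ⟨i + 2, by omega, rfl⟩

/-- If the Fibonacci sum is `n`, the sum of powers differs from `a + n ψ` by an integer, and both
lie in an open interval of length one. The converse is the irrationality of `ψ`. -/
theorem coe_R_eq_psiCount {n : ℕ} {a : ℤ} (h : (a : ℝ) + n * ψ ∈ Ioo (φ - 2) (φ - 1)) :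
    (R n : ℕ∞) = psiCount (a + n * ψ) := by
  rw [R_eq_ncard, (finite_setOf_sum_fib_eq n).cast_ncard_eq, psiCount]
  congr 1
  ext t
  have ht := psiSum_mem_Ioo t
  rw [mem_ofPred_eq, mem_ofPred_eq]
  rw [psiSum_eq] at ht ⊢
  constructor
  · rintro rfl
    rw [Int.cast_natCast (∑ i ∈ t, Nat.fib (i + 2))] at ht ⊢
    have h₁ : (a : ℝ) < ((∑ i ∈ t, Nat.fib (i + 1) : ℕ) : ℤ) + 1 := by linarith [h.2, ht.1]
    have h₂ : (((∑ i ∈ t, Nat.fib (i + 1) : ℕ) : ℤ) : ℝ) < a + 1 := by linarith [h.1, ht.2]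
    norm_cast at h₁ h₂
    have : a = ((∑ i ∈ t, Nat.fib (i + 1) : ℕ) : ℤ) := by omega
    rw [this]
  · intro e
    have := (add_mul_psi_inj (d := n) (by exact_mod_cast e)).2
    exact_mod_cast this

/-! ### Quotients of consecutive values of `R` -/

theorem psiCount_eq_R {y : ℝ} {n : ℕ} (a : ℤ) (hy : y = a + n * ψ) (hlo : φ - 2 < y)
    (hhi : y < φ - 1) : psiCount y = R n := by
  subst hy
  exact (coe_R_eq_psiCount ⟨hlo, hhi⟩).symm

theorem R_zero_pos : 0 < R 0 := by
  rw [R_eq_ncard, ncard_pos (finite_setOf_sum_fib_eq 0)]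
  exact ⟨∅, by simp⟩

theorem add_mul_psi_ne {a b c : ℤ} {n : ℕ} (hb : b < 0) : (a : ℝ) + b * ψ ≠ c + n * ψ := by
  intro h
  have := (add_mul_psi_inj (d := n) (by exact_mod_cast h)).2
  omega

/-- The puncture is `-1 - 2 ψ`, which belongs to the index `-2`. -/
theorem ne_puncture (c : ℤ) (n : ℕ) : (c : ℝ) + n * ψ ≠ 2 * φ - 3 := by
  have := (add_mul_psi_ne (a := -1) (b := -2) (c := c) (n := n) (by norm_num)).symm
  push_cast at this
  rw [psi_eq] at this ⊢
  contrapose! this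
  linarith

/-- The descent rests on `-φ y = (n - a) + a ψ`: the functional equation replaces the index `n` by
`a` when `y ≤ 0` and by `a - 1` when `0 < y`. -/
theorem R_pos_and_stabilizes (n : ℕ) : ∀ a : ℤ, φ - 2 < (a : ℝ) + n * ψ →
    (a : ℝ) + n * ψ < φ - 1 → 0 < R n ∧ Stabilizes (a + n * ψ) ((R (n + 1) : ℝ) / R n) := by
  have h₁ := phi_gt
  have h₂ := phi_lt
  have h₃ := phi_mul_self
  induction n using Nat.strong_induction_on with
  | _ n ih =>
  intro a lo hi
  obtain ⟨y, hy⟩ : ∃ y, y = (a : ℝ) + n * ψ := ⟨_, rfl⟩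
  rw [← hy] at lo hi ⊢
  rw [psi_eq] at hy
  have hn : (0 : ℝ) ≤ n := n.cast_nonneg
  have hnφ : n * (φ - 1) ≤ n * (1 : ℝ) := mul_le_mul_of_nonneg_left (by linarith) hn
  have hnφ' : 0 ≤ n * (φ - 1) := mul_nonneg hn (by linarith)
  have image₀ : -φ * y = (n - a : ℤ) + (a : ℝ) * ψ := by
    rw [hy, psi_eq]; push_cast; linear_combination (n : ℝ) * h₃
  have hRn : psiCount y = R n := psiCount_eq_R a (by rw [hy, psi_eq]) lo hi
  have ha : 0 ≤ a := by
    have : (-1 : ℝ) < a := by linarith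
    have : -1 < a := by exact_mod_cast this
    omega
  rcases le_or_gt y 0 with hy0 | hy0
  · -- here `R n` counts the representations of `a` as well
    have hRn1 : psiCount (y + (2 - φ)) = R (n + 1) :=
      psiCount_eq_R (a + 1) (by rw [hy, psi_eq]; push_cast; ring) (by linarith) (by linarith)
    obtain ⟨m, rfl⟩ := Int.eq_ofNat_of_zero_le ha
    rw [Int.cast_natCast] at image₀ hy
    have lo' : 0 ≤ -φ * y := by nlinarith
    have hi' : -φ * y < φ - 1 := by nlinarith
    have hRm : psiCount (-φ * y) = R m := psiCount_eq_R _ image₀ (by linarith) hi'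
    have hRnm : R n = R m := by
      have : (R n : ℕ∞) = R m := by rw [← hRn, ← hRm, psiCount_of_nonpos hy0]
      exact_mod_cast this
    -- For `n = 0` the index does not drop, but then `y = 0` lies on the plateau.
    rcases n.eq_zero_or_pos with rfl | hnpos
    · have hm : (m : ℝ) < 1 := by simp at hy; linarith
      obtain rfl : m = 0 := by
        have : m < 1 := by exact_mod_cast hm
        omega
      obtain rfl : y = 0 := by simp [hy]
      have e : (R (0 + 1) : ℕ∞) = R 0 := by
        rw [← hRn1, ← hRn, psiCount_of_le (by linarith)]
        congr 1
        linarith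
      have e : R (0 + 1) = R 0 := by exact_mod_cast e
      have hR := R_zero_pos
      refine ⟨hR, ?_⟩
      rw [e, div_self (by exact_mod_cast hR.ne')]
      exact .center (by linarith) le_rfl
    · have hmn : m < n := by
        have hn1 : (0 : ℝ) < n := by exact_mod_cast hnpos
        have : (m : ℝ) < n := by nlinarith
        exact_mod_cast this
      obtain ⟨hR, hS⟩ := ih m hmn (n - (m : ℤ)) (by rw [← image₀]; linarith)
        (by rw [← image₀]; exact hi')
      rw [← image₀] at hS
      have hRpos : 0 < R n := hRnm ▸ hR
      have hR0 : (R m : ℝ) ≠ 0 := by exact_mod_cast hR.ne'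
      refine ⟨hRpos, ?_⟩
      rcases lt_or_ge y (3 * φ - 5) with hy1 | hy1
      -- The recursion at `T y` leads to `T (-φ y)` and to `-φ y`, which have the indices `m + 1`
      -- and `m`.
      · have e : (R (n + 1) : ℕ∞) = R (m + 1) + R m := by
          rw [← hRn1, psiCount_eq_add]
          congr 1
          · refine psiCount_eq_R (n - (m : ℤ)) ?_ (by nlinarith) (by nlinarith)
            rw [show -φ * (y + (2 - φ)) = -φ * y + (1 - φ) by linear_combination h₃, image₀, psi_eq]
            push_cast
            ring
          · rw [← hRm]
            congr 1
            linear_combination h₃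
        have e : R (n + 1) = R (m + 1) + R m := by exact_mod_cast e
        convert! hS.left hy1 using 1
        rw [e, hRnm]
        push_cast
        field_simp
        ring
      · have e : (R (n + 1) : ℕ∞) = R n := by
          rw [← hRn1, psiCount_of_le (by linarith), hRnm, ← hRm]
          congr 1
          linear_combination h₃
        have e : R (n + 1) = R n := by exact_mod_cast e
        rw [e, hRnm, div_self hR0]
        exact .center hy1 hy0
  · obtain ⟨m, rfl⟩ : ∃ m : ℕ, a = m + 1 := by
      have : (0 : ℝ) < a := by linarith
      have : 0 < a := by exact_mod_cast this
      exact ⟨(a - 1).toNat, by omega⟩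
    have image₁ : -φ * y + (φ - 1) = (n - (m + 1) : ℤ) + (m : ℝ) * ψ := by
      rw [image₀, psi_eq]; push_cast; ring
    have hmn : m < n := by
      have : (m : ℝ) < n := by push_cast at hy; linarith
      exact_mod_cast this
    have mem : φ - 2 < -φ * y + (φ - 1) ∧ -φ * y + (φ - 1) < φ - 1 := by
      constructor <;> nlinarith
    obtain ⟨hR, hS⟩ := ih m hmn (n - (m + 1)) (by rw [← image₁]; exact mem.1)
      (by rw [← image₁]; exact mem.2)
    have hRm : psiCount (-φ * y + (φ - 1)) = R m := psiCount_eq_R _ image₁ mem.1 mem.2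
    rw [← image₁] at hS
    have hR0 : (0 : ℝ) < R m := by exact_mod_cast hR
    rcases lt_or_ge y (2 * φ - 3) with hy1 | hy1
    -- The point `-φ y` is the image under `T` of `-φ y + (φ - 1)`, hence the index `m + 1`.
    · have hRm1 : psiCount (-φ * y) = R (m + 1) :=
        psiCount_eq_R (n - (m + 1)) (by rw [image₀]; push_cast; rfl) (by nlinarith) (by nlinarith)
      have e : (R n : ℕ∞) = R (m + 1) + R m := by rw [← hRn, psiCount_eq_add, hRm, hRm1]
      have e : R n = R (m + 1) + R m := by exact_mod_cast e
      have e' : (R (n + 1) : ℕ∞) = R (m + 1) := by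
        rw [← hRm1, ← psiCount_eq_R (y := y + (2 - φ)) (m + 1 + 1)
          (by rw [hy, psi_eq]; push_cast; ring) (by linarith) (by linarith),
          psiCount_of_le (by linarith)]
        congr 1
        linear_combination h₃
      have e' : R (n + 1) = R (m + 1) := by exact_mod_cast e'
      refine ⟨by omega, ?_⟩
      convert! hS.mid hy0 hy1 using 1
      rw [e, e']
      push_cast
      have : (R m : ℝ) + R (m + 1) ≠ 0 := by positivity
      field_simp
      ring
    · have hne : y ≠ 2 * φ - 3 := by
        rw [hy, ← psi_eq]; exact ne_puncture _ _
      have hgt : 2 * φ - 3 < y := lt_of_le_of_ne hy1 hne.symm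
      have e : (R n : ℕ∞) = R m := by rw [← hRn, psiCount_of_le hy1, hRm]
      have e : R n = R m := by exact_mod_cast e
      have e' : (R (n + 1) : ℕ∞) = R (m + 1) := by
        rw [← psiCount_eq_R (y := y + (1 - φ)) (m + 1) (by rw [hy, psi_eq]; push_cast; ring)
          (by linarith) (by linarith), psiCount_of_nonpos (by linarith)]
        refine psiCount_eq_R (n - m) ?_ (by nlinarith) (by nlinarith)
        rw [show -φ * (y + (1 - φ)) = -φ * y + 1 by linear_combination h₃, image₀]
        push_cast
        ring
      have e' : R (n + 1) = R (m + 1) := by exact_mod_cast e'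
      rw [e, e']
      exact ⟨hR, hS.right hy1⟩

/-! ### Orbits of the rotation and patches -/

theorem exists_add_mul_psi_mem (n : ℕ) : ∃ a : ℤ, (a : ℝ) + n * ψ ∈ Ioo (φ - 2) (φ - 1) := by
  refine ⟨⌈φ - 2 - n * ψ⌉, lt_of_le_of_ne ?_ ?_, ?_⟩
  · linarith [Int.le_ceil (φ - 2 - n * ψ)]
  -- The left endpoint `φ - 2 = -1 - ψ` belongs to the index `-1`, so it is not hit.
  · have := add_mul_psi_ne (a := -1) (b := -1) (c := ⌈φ - 2 - n * ψ⌉) (n := n) (by norm_num)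
    convert! this using 1
    rw [psi_eq]
    push_cast
    ring
  · linarith [Int.ceil_lt_add_one (φ - 2 - n * ψ)]

theorem exists_T_iterate_eq {a : ℤ} {n : ℕ} (h : (a : ℝ) + n * ψ ∈ Ioo (φ - 2) (φ - 1)) (i : ℕ) :
    ∃ c : ℤ, T^[i] (a + n * ψ) = c + (n + i : ℕ) * ψ ∧
      (c : ℝ) + (n + i : ℕ) * ψ ∈ Ioo (φ - 2) (φ - 1) := by
  have h₁ := phi_gt
  have h₂ := phi_lt
  induction i with
  | zero => exact ⟨a, rfl, h⟩
  | succ i ih =>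
    obtain ⟨c, hc, lo, hi⟩ := ih
    rw [Function.iterate_succ_apply', hc, T_eq]
    split_ifs with hlt
    · have e : (c : ℝ) + (n + i : ℕ) * ψ + (2 - φ) =
          (c + 1 : ℤ) + (n + (i + 1) : ℕ) * ψ := by
        rw [psi_eq]; push_cast; ring
      refine ⟨c + 1, e, ?_⟩
      rw [← e]
      constructor <;> linarith
    · have e : (c : ℝ) + (n + i : ℕ) * ψ + (1 - φ) = c + (n + (i + 1) : ℕ) * ψ := by
        rw [psi_eq]; push_cast; ring
      -- `T` sends the puncture to the excluded endpoint `φ - 2`.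
      have := lt_of_le_of_ne (not_lt.1 hlt) (ne_puncture _ _).symm
      refine ⟨c, e, ?_⟩
      rw [← e]
      constructor <;> linarith

/-- The staircase function at the points of the orbit gives the quotients of consecutive values
of `R`. -/
theorem T_iterate_mem_D_and_h_eq {a : ℤ} {n : ℕ} (h : (a : ℝ) + n * ψ ∈ Ioo (φ - 2) (φ - 1))
    (i : ℕ) : T^[i] (a + n * ψ) ∈ D ∧ 0 < R (n + i) ∧
      FibPartition.h (T^[i] (a + n * ψ)) = (R (n + i + 1) : ℝ) / R (n + i) := by
  obtain ⟨c, hc, lo, hi⟩ := exists_T_iterate_eq h i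
  obtain ⟨hR, hS⟩ := R_pos_and_stabilizes (n + i) c lo hi
  rw [hc, D_eq]
  refine ⟨?_, hR, hS.h_eq⟩
  rcases lt_or_gt_of_ne (ne_puncture c (n + i)) with hlt | hgt
  · exact .inl ⟨lo, hlt⟩
  · exact .inr ⟨hgt, hi⟩

theorem containsPatch_iff_mem_window {k : ℕ} (p : Fin k → ℚ) {a : ℤ} {n : ℕ}
    (h : (a : ℝ) + n * ψ ∈ Ioo (φ - 2) (φ - 1)) :
    ContainsPatch p n ↔ (a : ℝ) + n * ψ ∈ window p := by
  set c : Fin (k + 1) → ℚ := Fin.cons 1 p with hc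
  have hpatch : ContainsPatch p n ↔ ∀ i : Fin k, (R (n + i + 1) : ℚ) = c i.succ * R n := Iff.rfl
  have hwindow : (a : ℝ) + n * ψ ∈ window p ↔
      ∀ i : Fin k, (R (n + i + 1) : ℚ) * c i.castSucc = c i.succ * R (n + i) := by
    rw [window, mem_ofPred_eq, neg_one_div_phi_sq, one_div_phi, ← hc]
    refine (and_iff_right h).trans (forall_congr' fun i => ?_)
    obtain ⟨hD, hR, hh⟩ := T_iterate_mem_D_and_h_eq h i
    have hR0 : (R (n + i) : ℝ) ≠ 0 := by exact_mod_cast hR.ne'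
    rw [and_iff_right hD, hh, div_mul_eq_mul_div, div_eq_iff hR0]
    norm_cast
  rw [hpatch, hwindow]
  constructor
  · intro H
    have H' : ∀ j : Fin (k + 1), (R (n + j) : ℚ) = c j * R n := by
      intro j
      induction j using Fin.cases with
      | zero => simp [hc]
      | succ i => exact H i
    intro i
    have := H' i.castSucc
    rw [Fin.val_castSucc] at this
    rw [H i, this]
    ring
  · intro H
    have H' : ∀ j : Fin (k + 1), (R (n + j) : ℚ) = c j * R n := by
      intro j
      induction j using Fin.induction with
      | zero => simp [hc]
      | succ i ih =>
        -- Cancelling `R (n + i)` telescopes the quotients without dividing by an entry of the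
        -- patch, which might be zero.
        have hR : (R (n + i) : ℚ) ≠ 0 := by
          exact_mod_cast (T_iterate_mem_D_and_h_eq h i).2.1.ne'
        rw [Fin.val_castSucc] at ih
        refine mul_right_cancel₀ hR ?_
        rw [Fin.val_succ, ← add_assoc, mul_right_comm, ← H i, ih]
        ring
    exact fun i => H' i.succ

end FibPartition

theorem theorem2 :
    (FibPartition.IsStaircase FibPartition.h ∧
      ∀ g : ℝ → ℝ, FibPartition.IsStaircase g →
        Set.EqOn g FibPartition.h FibPartition.D) ∧
    ∀ (k : ℕ) (p : Fin k → ℚ),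
      FibPartition.IsFiniteUnionOfIntervals (FibPartition.window p) ∧
      FibPartition.IsCutAndProjectSet
        (FibPartition.goldenCutAndProject (FibPartition.window p)) ∧
      (fun n : ℕ => (n : ℝ)) '' {n : ℕ | FibPartition.ContainsPatch p n} =
        FibPartition.goldenCutAndProject (FibPartition.window p) ∩ Set.Ici 0 := by
  refine ⟨⟨FibPartition.isStaircase_h, fun g hg => hg.eqOn_h⟩, fun k p => ?_⟩
  have hW := FibPartition.isFiniteUnionOfIntervals_window p
  refine ⟨hW, FibPartition.isCutAndProjectSet_goldenCutAndProject hW fun y hy => hy.1, ?_⟩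
  ext t
  rw [mem_inter_iff, FibPartition.mem_goldenCutAndProject]
  constructor
  · rintro ⟨n, hn, rfl⟩
    obtain ⟨a, ha⟩ := FibPartition.exists_add_mul_psi_mem n
    exact ⟨⟨a, n, by simpa using (FibPartition.containsPatch_iff_mem_window p ha).1 hn, by simp⟩,
      mem_Ici.2 n.cast_nonneg⟩
  · rintro ⟨⟨a, b, hab, rfl⟩, hb⟩
    have hb : 0 ≤ b := by exact_mod_cast mem_Ici.1 hb
    obtain ⟨n, rfl⟩ := Int.eq_ofNat_of_zero_le hb
    rw [Int.cast_natCast] at hab ⊢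
    have ha := hab.1
    rw [FibPartition.neg_one_div_phi_sq, FibPartition.one_div_phi] at ha
    exact ⟨n, (FibPartition.containsPatch_iff_mem_window p ha).2 hab, rfl⟩
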